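/- Let $T=(V,E)$ be a finite tree that is not a path. For $a\in V$ and nonempty $S\subseteq V$ put $d(a,S)=\min_{v\in S}d(a,v)$, where $d$ is the graph distance of $T$. A partition $\Pi$ of $V$ is a $k$-partition generator of $T$ if for any two different vertices $x,y$ there are at least $k$ sets $S\in\Pi$ with $d(x,S)\ne d(y,S)$; the $k$-partition dimension $\operatorname{pd}_k(T)$ is the minimum cardinality of a $k$-partition generator of $T$. A major vertex is a vertex of degree at least three. A vertex $u$ of degree one is a terminal vertex of a major vertex $v$ if $d(u,v)<d(u,w)$ for every other major vertex $w$; the number of terminal vertices of $v$ is its terminal degree $\operatorname{ter}(v)$. Let $\mathcal{M}(T)$ be the set of major vertices with $\operatorname{ter}(v)>1$, and put $\kappa=|\mathcal{M}(T)|$, $\tau=\max_{w\in\mathcal{M}(T)}\operatorname{ter}(w)$, and let $\varsigma(T)$ be the minimum of $d(u,w)+d(w,v)$ over all $w\in\mathcal{M}(T)$ and all pairs of different terminal vertices $u,v$ of $w$. Then a $2$-partition generator of $T$ exists and $$\operatorname{pd}_2(T)\le 2\kappa+\tau-1 .$$ Moreover, if $\varsigma(T)\ge 3$, then a $3$-partition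 generator of $T$ exists and $$\operatorname{pd}_3(T)\le 3\kappa+2\tau-3 .$$ -/

import Mathlib

namespace SimpleGraph

variable {V : Type*}

/-- The distance `d(a, S) = min_{v ∈ S} d(a, v)` from a vertex to a set of vertices. It is only
used for nonempty `S` (the parts of a partition) in a connected graph. -/
noncomputable def distToSet (G : SimpleGraph V) (a : V) (S : Finset V) : ℕ :=
  sInf (G.dist a '' (S : Set V))

section PartitionDimension

variable [Fintype V] [DecidableEq V]

/-- A partition `P` of the vertex set is a `k`-partition generator if any two different vertices
are distinguished by at least `k` of the vertex sets of `P`. -/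
def IsPartitionGenerator (G : SimpleGraph V) (k : ℕ)
    (P : Finpartition (Finset.univ : Finset V)) : Prop :=
  ∀ x y : V, x ≠ y →
    k ≤ (P.parts.filter (fun S => G.distToSet x S ≠ G.distToSet y S)).card

/-- The `k`-partition dimension: the minimum number of parts of a `k`-partition generator. It is
`⊤` when there is no `k`-partition generator, so a finite upper bound includes existence. -/
noncomputable def partitionDim (G : SimpleGraph V) (k : ℕ) : ℕ∞ :=
  ⨅ (P : Finpartition (Finset.univ : Finset V)) (_ : G.IsPartitionGenerator k P),
    (P.parts.card : ℕ∞)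

end PartitionDimension

section MajorVertices

variable [Fintype V] (G : SimpleGraph V) [DecidableRel G.Adj]

/-- A major vertex is a vertex of degree at least three. -/
def IsMajorVertex (v : V) : Prop := 3 ≤ G.degree v

/-- `u` is a terminal vertex of the major vertex `v` if `u` is an end vertex which is strictly
closer to `v` than to every other major vertex. -/
def IsTerminalVertexOf (u v : V) : Prop :=
  G.IsMajorVertex v ∧ G.degree u = 1 ∧
    ∀ w : V, G.IsMajorVertex w → w ≠ v → G.dist u v < G.dist u w

open Classical in
/-- The set `U(v)` of terminal vertices of `v`. -/
noncomputable def terminalVertices (v : V) : Finset V :=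
  Finset.univ.filter (fun u => G.IsTerminalVertexOf u v)

/-- The terminal degree `ter(v) = |U(v)|`. -/
noncomputable def terminalDegree (v : V) : ℕ := (G.terminalVertices v).card

open Classical in
/-- The set `𝓜(G)` of (exterior) major vertices with terminal degree greater than one. -/
noncomputable def multiExteriorMajor : Finset V :=
  Finset.univ.filter (fun v => G.IsMajorVertex v ∧ 1 < G.terminalDegree v)

/-- `τ`, the maximum of `ter(w)` over `w ∈ 𝓜(G)`. -/
noncomputable def maxTerminalDegree : ℕ := G.multiExteriorMajor.sup G.terminalDegree

/-- `ς(w)`: the minimum over pairs of different terminal vertices `u, v` of `w` of the length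
`d(u, w) + d(w, v)` of the path from `u` to `v` through `w`. -/
noncomputable def localVarsigma (w : V) : ℕ∞ :=
  ⨅ (u ∈ G.terminalVertices w) (v ∈ G.terminalVertices w) (_ : u ≠ v),
    ((G.dist u w + G.dist w v : ℕ) : ℕ∞)

/-- `ς(G)`: the minimum of `ς(w)` over `w ∈ 𝓜(G)`. -/
noncomputable def varsigma : ℕ∞ := ⨅ w ∈ G.multiExteriorMajor, G.localVarsigma w

end MajorVertices

end SimpleGraph

/-!
All arguments run on distances. For adjacent `m`, `n` the component of `T - m` containing `n` is
the branch `{z | d(z, n) + 1 = d(z, m)}`, and a geodesic leaving a branch passes through `m`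
(`IsTree.dist_eq_add_of_inBranch`). A leg of a major vertex is a branch without major vertices, a
leg root is a major vertex with at least two legs. The end of a leg of `w` is a terminal vertex of
`w` (`IsTree.exists_terminal_of_isLeg`), so leg roots belong to `𝓜(T)` and have at most `τ` legs.

The key fact is `IsTree.exists_legs_of_dist_eq`: the distances to the leg roots tell any two
vertices `x`, `y` apart, except when `x` and `y` lie on different legs of one root, equally far
from it. Indeed, let `m` be the equidistant vertex closest to `x`. If no leg root tells `x` and `y`
apart, then their branches at `m` contain no leg root, hence no major vertex, so both are legs.

The parts of the partitions are legs (for `k = 2`) or pieces of legs (for `k = 3`), and the rest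
of the tree. Every leg root keeps the parts of its first two legs for itself, and the other legs
are merged over all leg roots according to their index, which bounds the number of parts. Seen from
outside its leg, a private part of `w` measures the distance to `w` up to a constant. So if `x`
and `y` have different distances to `w`, the private parts of `w` (together with the rest, which
measures the distance to `w` from inside the legs) distinguish them. Vertices in different parts
are moreover distinguished by those two parts. In the exceptional case of the key fact the parts
differ, which suffices for `k = 2`. For `k = 3` one of the two legs has been cut in two, and its
other piece is the third part. Cutting all legs but one of each root is possible when `ς ≥ 3`,
since then at most one leg of a root is a single vertex.
-/

namespace SimpleGraph

/-! ### Branches of a tree -/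

section Branches

variable {V : Type*} {T : SimpleGraph V}

/-- For adjacent `m` and `n` in a tree, `T.InBranch m n z` says that `z` lies in the component
of `T - m` that contains `n`, expressed by distances. -/
def InBranch (T : SimpleGraph V) (m n z : V) : Prop := T.dist z n + 1 = T.dist z m

theorem inBranch_self {m n : V} (h : T.Adj m n) : T.InBranch m n n := by
  simp [InBranch, dist_eq_one_iff_adj.2 h.symm]

theorem not_inBranch_root (m n : V) : ¬ T.InBranch m n m := by
  simp [InBranch]

theorem dist_pos_of_inBranch {m n z : V} (h : T.InBranch m n z) : 0 < T.dist z m := by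
  unfold InBranch at h; omega

theorem IsTree.dist_of_not_inBranch (hT : T.IsTree) {m n z : V} (h : T.Adj m n)
    (hz : ¬ T.InBranch m n z) : T.dist z n = T.dist z m + 1 := by
  rcases hT.dist_eq_dist_add_one_of_adj z h with h1 | h1
  · exact absurd h1.symm hz
  · exact h1

theorem Connected.exists_inBranch (hc : T.Connected) {m z : V} (h : z ≠ m) :
    ∃ n, T.Adj m n ∧ T.InBranch m n z := by
  obtain ⟨p, hp⟩ := hc.exists_walk_length_eq_dist m z
  cases p with
  | nil => exact absurd rfl h
  | @cons _ n _ hadj q =>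
    refine ⟨n, hadj, ?_⟩
    have h1 := T.dist_le q
    have h2 := hc.dist_triangle (u := m) (v := n) (w := z)
    have h3 := dist_eq_one_iff_adj.2 hadj
    simp only [Walk.length_cons] at hp
    unfold InBranch
    rw [T.dist_comm (u := z) (v := n), T.dist_comm (u := z) (v := m)]
    omega

theorem IsTree.inBranch_unique (hT : T.IsTree) {m n n' z : V} (h : T.Adj m n) (h' : T.Adj m n')
    (hz : T.InBranch m n z) (hz' : T.InBranch m n' z) : n = n' := by
  obtain ⟨p, hp⟩ := hT.connected.exists_walk_length_eq_dist n z
  obtain ⟨q, hq⟩ := hT.connected.exists_walk_length_eq_dist n' z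
  unfold InBranch at hz hz'
  rw [T.dist_comm (u := z), T.dist_comm (u := z)] at hz hz'
  have h1 : (Walk.cons h p).IsPath := Walk.isPath_of_length_eq_dist _ (by simp; omega)
  have h2 : (Walk.cons h' q).IsPath := Walk.isPath_of_length_eq_dist _ (by simp; omega)
  have h3 := (hT.isAcyclic.subsingleton_path m z).elim ⟨_, h1⟩ ⟨_, h2⟩
  have h4 := congrArg (fun r : T.Path m z => r.1.snd) h3
  simpa using h4

/-- A geodesic that leaves a branch passes through its root. -/
theorem IsTree.dist_eq_add_of_inBranch (hT : T.IsTree) {m n z y : V} (h : T.Adj m n)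
    (hz : T.InBranch m n z) (hy : ¬ T.InBranch m n y) :
    T.dist z y = T.dist z m + T.dist y m := by
  induction hd : T.dist y m using Nat.strong_induction_on generalizing y with
  | _ k ih =>
  by_cases hym : y = m
  · subst hym; simp at hd; simp [← hd]
  obtain ⟨y', hyy', hy'⟩ := hT.connected.exists_inBranch (Ne.symm hym)
  have hyn := hT.dist_of_not_inBranch h hy
  unfold InBranch at hy'
  rw [T.dist_comm (u := m), T.dist_comm (u := m)] at hy'
  have hy'n : ¬ T.InBranch m n y' := by
    intro hc
    have := hT.connected.dist_triangle (u := y) (v := y') (w := n)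
    have := dist_eq_one_iff_adj.2 hyy'
    unfold InBranch at hc
    omega
  have hd' := ih (T.dist y' m) (by omega) hy'n rfl
  rcases hT.dist_eq_dist_add_one_of_adj z hyy' with h1 | h1
  · omega
  -- otherwise `y` is the neighbour of `y'` towards `z`, but that neighbour is towards `m`
  · exfalso
    have hb : T.InBranch y' y z := h1.symm
    by_cases hym' : y' = m
    · subst hym'
      have := hT.inBranch_unique hyy'.symm h hb hz
      subst this
      exact hy (inBranch_self h)
    · obtain ⟨q, hq, hqm⟩ := hT.connected.exists_inBranch (Ne.symm hym')
      have hqz : T.InBranch y' q z := by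
        have h2 := hT.connected.dist_triangle (u := z) (v := m) (w := q)
        rcases hT.dist_eq_dist_add_one_of_adj z hq with h3 | h3
        · exact h3.symm
        · unfold InBranch at hqm
          rw [T.dist_comm (u := m), T.dist_comm (u := m)] at hqm
          rw [T.dist_comm (u := m)] at h2
          omega
      have := hT.inBranch_unique hyy'.symm hq hb hqz
      subst this
      unfold InBranch at hqm
      rw [T.dist_comm (u := m), T.dist_comm (u := m)] at hqm
      omega

/-- Below a vertex `v` of a branch, every branch at `v` that avoids the root is nested in the
given branch, and its vertices are farther from the root than `v`. -/
theorem IsTree.inBranch_of_inBranch (hT : T.IsTree) {m n v p z : V} (h : T.Adj m n)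
    (hv : T.InBranch m n v) (hvp : T.Adj v p) (hp : ¬ T.InBranch v p m)
    (hz : T.InBranch v p z) : T.InBranch m n z ∧ T.dist z m = T.dist z v + T.dist v m := by
  have h1 := hT.dist_eq_add_of_inBranch hvp hz hp
  rw [T.dist_comm (u := m)] at h1
  refine ⟨?_, h1⟩
  by_contra hc
  have h2 := hT.dist_eq_add_of_inBranch h hv hc
  have h3 := dist_pos_of_inBranch hz
  have h4 := dist_pos_of_inBranch hv
  rw [T.dist_comm (u := v) (v := z)] at h2
  omega

/-- If `x ≠ y` have a common equidistant vertex, then they have one at which they lie in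
different branches. -/
theorem IsTree.exists_branching_of_dist_eq (hT : T.IsTree) [Finite V] {x y w : V} (hxy : x ≠ y)
    (hw : T.dist x w = T.dist y w) :
    ∃ m n n', T.Adj m n ∧ T.Adj m n' ∧ n ≠ n' ∧ T.InBranch m n x ∧ T.InBranch m n' y ∧
      T.dist x m = T.dist y m := by
  -- an equidistant vertex as close as possible to `x`
  obtain ⟨m, hm, hmin⟩ := Set.exists_min_image {m | T.dist x m = T.dist y m} (T.dist x)
    (Set.toFinite _) ⟨w, hw⟩
  simp only [Set.mem_ofPred_eq] at hm hmin
  have hxm : x ≠ m := by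
    rintro rfl
    rw [dist_self] at hm
    exact hxy ((hT.connected.dist_eq_zero_iff.1 hm.symm).symm)
  have hym : y ≠ m := by
    rintro rfl
    rw [dist_self] at hm
    exact hxy (hT.connected.dist_eq_zero_iff.1 hm)
  obtain ⟨n, hn, hnx⟩ := hT.connected.exists_inBranch hxm
  obtain ⟨n', hn', hny⟩ := hT.connected.exists_inBranch hym
  refine ⟨m, n, n', hn, hn', ?_, hnx, hny, hm⟩
  rintro rfl
  unfold InBranch at hnx hny
  have := hmin n (by omega)
  omega

end Branches

/-! ### Trees without major vertices -/

section Path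

variable {V : Type*} [Fintype V] {T : SimpleGraph V} [DecidableRel T.Adj]

theorem three_le_degree {v a b c : V} (ha : T.Adj v a) (hb : T.Adj v b) (hc : T.Adj v c)
    (hab : a ≠ b) (hac : a ≠ c) (hbc : b ≠ c) : 3 ≤ T.degree v := by
  classical
  rw [← card_neighborFinset_eq_degree]
  have : ({a, b, c} : Finset V) ⊆ T.neighborFinset v := by
    intro z; simp only [Finset.mem_insert, Finset.mem_singleton, mem_neighborFinset]
    rintro (rfl | rfl | rfl) <;> assumption
  have h := Finset.card_le_card this
  rwa [Finset.card_eq_three.2 ⟨a, b, c, hab, hac, hbc, rfl⟩] at h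

/-- In a branch without major vertices, vertices are determined by their distance to the root. -/
theorem IsTree.eq_of_dist_eq_of_inBranch (hT : T.IsTree) {m n x y : V} (h : T.Adj m n)
    (hmaj : ∀ v, T.InBranch m n v → ¬ T.IsMajorVertex v)
    (hx : T.InBranch m n x) (hy : T.InBranch m n y) (hd : T.dist x m = T.dist y m) : x = y := by
  by_contra hxy
  obtain ⟨p, a, b, ha, hb, hab, hpa, hpb, hp⟩ := hT.exists_branching_of_dist_eq hxy hd
  by_cases hpm : m = p
  · subst hpm
    exact hab ((hT.inBranch_unique ha h hpa hx).trans (hT.inBranch_unique hb h hpb hy).symm)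
  obtain ⟨c, hc, hpc⟩ := hT.connected.exists_inBranch hpm
  -- the root cannot be in the branch of `x` or `y` at `p`, by the triangle equality
  have hca : a ≠ c := by
    rintro rfl
    have h1 := hT.dist_eq_add_of_inBranch hc hpc
      (fun hyc => hab (hT.inBranch_unique hc hb hyc hpb))
    have h2 := hT.connected.dist_triangle (u := x) (v := a) (w := m)
    unfold InBranch at hpa hpc
    rw [T.dist_comm (u := m) (v := y)] at h1
    rw [T.dist_comm (u := m) (v := a)] at hpc
    omega
  have hcb : b ≠ c := by
    rintro rfl
    have h1 := hT.dist_eq_add_of_inBranch hc hpc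
      (fun hxc => hab (hT.inBranch_unique ha hc hpa hxc))
    have h2 := hT.connected.dist_triangle (u := y) (v := b) (w := m)
    unfold InBranch at hpb hpc
    rw [T.dist_comm (u := m) (v := x)] at h1
    rw [T.dist_comm (u := m) (v := b)] at hpc
    omega
  refine hmaj p ?_ (three_le_degree ha hb hc hab hca hcb)
  by_contra hpn
  have h1 := hT.dist_eq_add_of_inBranch h hx hpn
  have h2 := hT.dist_eq_add_of_inBranch hc hpc (fun hxc => hca (hT.inBranch_unique ha hc hpa hxc))
  have h3 := hT.connected.pos_dist_of_ne (Ne.symm hpm)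
  rw [T.dist_comm (u := m) (v := x), T.dist_comm (u := m)] at h2
  omega

theorem IsTree.exists_isMajorVertex (hT : T.IsTree)
    (hpath : ¬ ∃ n : ℕ, Nonempty (T ≃g SimpleGraph.pathGraph n)) : ∃ v, T.IsMajorVertex v := by
  by_contra! hno
  refine hpath ⟨Fintype.card V, ?_⟩
  obtain ⟨v⟩ := hT.connected.nonempty
  -- a vertex `r` farthest from some vertex is an end of the path
  obtain ⟨r, -, hr⟩ := Finset.exists_max_image (Finset.univ : Finset V) (T.dist v) ⟨v, by simp⟩
  have hr' : ∀ n, T.Adj r n → T.InBranch r n v := by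
    intro n hn
    rcases hT.dist_eq_dist_add_one_of_adj v hn with h | h
    · exact h.symm
    · have := hr n (by simp)
      omega
  have hinj : Function.Injective (T.dist r) := by
    intro x y hxy
    by_cases hxr : x = r
    · subst hxr
      rw [dist_self] at hxy
      exact hT.connected.dist_eq_zero_iff.1 hxy.symm
    by_cases hyr : y = r
    · subst hyr
      rw [dist_self] at hxy
      exact (hT.connected.dist_eq_zero_iff.1 hxy).symm
    obtain ⟨n, hn, hnx⟩ := hT.connected.exists_inBranch hxr
    obtain ⟨n', hn', hny⟩ := hT.connected.exists_inBranch hyr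
    have := hT.inBranch_unique hn hn' (hr' n hn) (hr' n' hn')
    subst this
    refine hT.eq_of_dist_eq_of_inBranch hn (fun v _ => hno v) hnx hny ?_
    rw [T.dist_comm, hxy, T.dist_comm]
  have hlt : ∀ x, T.dist r x < Fintype.card V := by
    intro x
    obtain ⟨p, hp, hpl⟩ := hT.connected.exists_path_of_dist r x
    rw [← hpl]
    exact hp.length_lt
  let f : V → Fin (Fintype.card V) := fun x => ⟨T.dist r x, hlt x⟩
  have hf : Function.Bijective f := by
    rw [Fintype.bijective_iff_injective_and_card]
    exact ⟨fun x y hxy => hinj (by simpa [f] using hxy), by simp⟩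
  have hstep : ∀ x y, T.dist r x + 1 = T.dist r y → T.Adj x y := by
    intro x y hxy
    have hyr : r ≠ y := by rintro rfl; simp at hxy
    obtain ⟨q, hq, hqr⟩ := hT.connected.exists_inBranch hyr
    unfold InBranch at hqr
    have : q = x := hinj (by omega)
    exact this ▸ hq.symm
  refine ⟨⟨Equiv.ofBijective f hf, ?_⟩⟩
  intro x y
  simp only [Equiv.ofBijective_apply, pathGraph_adj, f]
  constructor
  · rintro (h | h)
    · exact hstep _ _ h
    · exact (hstep _ _ h).symm
  · intro h
    rcases hT.dist_eq_dist_add_one_of_adj r h with h | h <;> omega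

end Path

/-! ### Legs -/

section Legs

variable {V : Type*} [Fintype V] {T : SimpleGraph V} [DecidableRel T.Adj]

/-- The neighbour `n` of `w` is the first vertex of a leg of `w`: the branch at `w` through `n`
contains no major vertex. -/
def IsLeg (T : SimpleGraph V) [DecidableRel T.Adj] (w n : V) : Prop :=
  T.Adj w n ∧ ∀ v, T.InBranch w n v → ¬ T.IsMajorVertex v

open Classical in
/-- The legs of `w`, each represented by its first vertex. -/
noncomputable def legs (T : SimpleGraph V) [DecidableRel T.Adj] (w : V) : Finset V :=
  Finset.univ.filter (T.IsLeg w)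

/-- A major vertex with at least two legs. -/
def IsLegRoot (T : SimpleGraph V) [DecidableRel T.Adj] (w : V) : Prop :=
  T.IsMajorVertex w ∧ 1 < (T.legs w).card

theorem mem_legs {w n : V} : n ∈ T.legs w ↔ T.IsLeg w n := by simp [legs]

/-- The farthest vertex of a leg is a terminal vertex of the root. -/
theorem IsTree.exists_terminal_of_isLeg (hT : T.IsTree) {w n : V} (hw : T.IsMajorVertex w)
    (hn : T.IsLeg w n) : ∃ u, T.InBranch w n u ∧ T.IsTerminalVertexOf u w := by
  obtain ⟨u, hu, hmax⟩ := Set.exists_max_image {u | T.InBranch w n u} (fun u => T.dist u w)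
    (Set.toFinite _) ⟨n, inBranch_self hn.1⟩
  simp only [Set.mem_ofPred_eq] at hu hmax
  refine ⟨u, hu, hw, ?_, ?_⟩
  · have huw : w ≠ u := by rintro rfl; exact not_inBranch_root _ _ hu
    obtain ⟨p, hp, hpw⟩ := hT.connected.exists_inBranch huw
    rw [degree_eq_one_iff_existsUnique_adj]
    refine ⟨p, hp, fun q hq => ?_⟩
    by_contra hqp
    have hqw : ¬ T.InBranch u q w := fun h => hqp (hT.inBranch_unique hq hp h hpw)
    obtain ⟨h1, h2⟩ := hT.inBranch_of_inBranch hn.1 hu hq hqw (inBranch_self hq)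
    have h3 := hmax q h1
    have h4 := dist_eq_one_iff_adj.2 hq.symm
    omega
  · intro v hv hvw
    have h1 := hT.dist_eq_add_of_inBranch hn.1 hu (fun h => hn.2 v h hv)
    have h2 := hT.connected.pos_dist_of_ne hvw
    omega

theorem IsTree.card_legs_le (hT : T.IsTree) {w : V} (hw : T.IsMajorVertex w) :
    (T.legs w).card ≤ T.terminalDegree w := by
  classical
  have h : ∀ n, ∃ u, T.IsLeg w n → T.InBranch w n u ∧ T.IsTerminalVertexOf u w := by
    intro n
    by_cases hn : T.IsLeg w n
    · obtain ⟨u, hu⟩ := hT.exists_terminal_of_isLeg hw hn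
      exact ⟨u, fun _ => hu⟩
    · exact ⟨n, fun h => absurd h hn⟩
  choose f hf using h
  refine Finset.card_le_card_of_injOn f ?_ ?_
  · intro n hn
    simpa [terminalVertices] using (hf n (mem_legs.1 hn)).2
  · intro n hn n' hn' hnn
    have h1 := mem_legs.1 hn
    have h2 := mem_legs.1 hn'
    exact hT.inBranch_unique h1.1 h2.1 (hf n h1).1 (hnn ▸ (hf n' h2).1)

theorem IsLegRoot.mem_multiExteriorMajor (hT : T.IsTree) {w : V} (hw : T.IsLegRoot w) :
    w ∈ T.multiExteriorMajor := by
  simp only [multiExteriorMajor, Finset.mem_filter, Finset.mem_univ, true_and]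
  exact ⟨hw.1, hw.2.trans_le (hT.card_legs_le hw.1)⟩

theorem IsLegRoot.card_legs_le_maxTerminalDegree (hT : T.IsTree) {w : V} (hw : T.IsLegRoot w) :
    (T.legs w).card ≤ T.maxTerminalDegree :=
  (hT.card_legs_le hw.1).trans (Finset.le_sup (f := T.terminalDegree)
    (hw.mem_multiExteriorMajor hT))

theorem isLegRoot_of_ne {w n n' : V} (hw : T.IsMajorVertex w) (hn : T.IsLeg w n)
    (hn' : T.IsLeg w n') (h : n ≠ n') : T.IsLegRoot w :=
  ⟨hw, Finset.one_lt_card.2 ⟨n, mem_legs.2 hn, n', mem_legs.2 hn', h⟩⟩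

/-- A branch with a major vertex contains a leg root, namely a major vertex farthest from the
root of the branch. -/
theorem IsTree.isLeg_or_exists_isLegRoot (hT : T.IsTree) {m n : V} (h : T.Adj m n) :
    T.IsLeg m n ∨ ∃ w, T.InBranch m n w ∧ T.IsLegRoot w := by
  classical
  by_cases hno : ∃ v, T.InBranch m n v ∧ T.IsMajorVertex v
  swap
  · push Not at hno
    exact Or.inl ⟨h, hno⟩
  right
  obtain ⟨w, ⟨hw, hwm⟩, hmax⟩ := Set.exists_max_image
    {v | T.InBranch m n v ∧ T.IsMajorVertex v} (fun v => T.dist v m) (Set.toFinite _) hno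
  refine ⟨w, hw, hwm, ?_⟩
  have hmw : m ≠ w := by rintro rfl; exact not_inBranch_root _ _ hw
  obtain ⟨p, hp, hpm⟩ := hT.connected.exists_inBranch hmw
  have hsub : (T.neighborFinset w).erase p ⊆ T.legs w := by
    intro q hq
    rw [Finset.mem_erase, mem_neighborFinset] at hq
    have hqm : ¬ T.InBranch w q m := fun hc => hq.1 (hT.inBranch_unique hq.2 hp hc hpm)
    rw [mem_legs]
    refine ⟨hq.2, fun v hv hvm => ?_⟩
    obtain ⟨h1, h2⟩ := hT.inBranch_of_inBranch h hw hq.2 hqm hv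
    have h3 := hmax v ⟨h1, hvm⟩
    have h4 := dist_pos_of_inBranch hv
    omega
  have h1 := Finset.card_le_card hsub
  have h2 := Finset.pred_card_le_card_erase (s := T.neighborFinset w) (a := p)
  rw [card_neighborFinset_eq_degree] at h2
  unfold IsMajorVertex at hwm
  omega

theorem IsTree.exists_isLegRoot (hT : T.IsTree)
    (hpath : ¬ ∃ n : ℕ, Nonempty (T ≃g SimpleGraph.pathGraph n)) : ∃ w, T.IsLegRoot w := by
  obtain ⟨r, hr⟩ := hT.exists_isMajorVertex hpath
  by_contra! hno
  have hsub : T.neighborFinset r ⊆ T.legs r := by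
    intro n hn
    rw [mem_neighborFinset] at hn
    rcases hT.isLeg_or_exists_isLegRoot hn with h | ⟨w, -, hw⟩
    · exact mem_legs.2 h
    · exact absurd hw (hno w)
  have h1 := Finset.card_le_card hsub
  rw [card_neighborFinset_eq_degree] at h1
  unfold IsMajorVertex at hr
  exact hno r ⟨hr, by omega⟩

/-- Two vertices that are not told apart by their distances to the leg roots lie on different
legs of the same root. -/
theorem IsTree.exists_legs_of_dist_eq (hT : T.IsTree)
    (hpath : ¬ ∃ n : ℕ, Nonempty (T ≃g SimpleGraph.pathGraph n)) {x y : V} (hxy : x ≠ y)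
    (h : ∀ w, T.IsLegRoot w → T.dist x w = T.dist y w) :
    ∃ w n n', T.IsLegRoot w ∧ T.IsLeg w n ∧ T.IsLeg w n' ∧ n ≠ n' ∧ T.InBranch w n x ∧
      T.InBranch w n' y ∧ T.dist x w = T.dist y w := by
  obtain ⟨w₀, hw₀⟩ := hT.exists_isLegRoot hpath
  obtain ⟨m, n, n', hn, hn', hnn, hx, hy, hm⟩ := hT.exists_branching_of_dist_eq hxy (h w₀ hw₀)
  -- a leg root in the branch of `x` or `y` at `m` would be closer to that vertex
  have key : ∀ {a b x y : V}, T.Adj m a → T.Adj m b → a ≠ b → T.InBranch m a x →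
      T.InBranch m b y → T.dist x m = T.dist y m →
      (∀ w, T.IsLegRoot w → T.dist x w = T.dist y w) → T.IsLeg m a := by
    intro a b x y ha hb hab hx hy hm h
    rcases hT.isLeg_or_exists_isLegRoot ha with h1 | ⟨w, hw, hwr⟩
    · exact h1
    · exfalso
      have h1 := hT.dist_eq_add_of_inBranch ha hw
        (fun hc => hab (hT.inBranch_unique ha hb hc hy))
      have h2 := hT.connected.dist_triangle (u := x) (v := a) (w := w)
      have h3 := h w hwr
      unfold InBranch at hx hw
      rw [T.dist_comm (u := w) (v := y)] at h1
      rw [T.dist_comm (u := w) (v := a)] at hw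
      omega
  have hln := key hn hn' hnn hx hy hm h
  have hln' := key hn' hn hnn.symm hy hx hm.symm (fun w hw => (h w hw).symm)
  refine ⟨m, n, n', ?_, hln, hln', hnn, hx, hy, hm⟩
  refine isLegRoot_of_ne ?_ hln hln' hnn
  by_cases hmw : w₀ = m
  · exact hmw ▸ hw₀.1
  obtain ⟨c, hc, hcw⟩ := hT.connected.exists_inBranch hmw
  refine three_le_degree hn hn' hc hnn ?_ ?_
  · rintro rfl; exact hln.2 _ hcw hw₀.1
  · rintro rfl; exact hln'.2 _ hcw hw₀.1

/-- The vertex `x` lies on the leg of the leg root `w` with first vertex `n`. -/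
structure OnLeg (T : SimpleGraph V) [DecidableRel T.Adj] (w n x : V) : Prop where
  root : T.IsLegRoot w
  leg : T.IsLeg w n
  mem : T.InBranch w n x

theorem OnLeg.unique (hT : T.IsTree) {w w' n n' x : V} (h : T.OnLeg w n x)
    (h' : T.OnLeg w' n' x) : w = w' ∧ n = n' := by
  have hww : w = w' := by
    by_contra hne
    have h1 := hT.dist_eq_add_of_inBranch h.leg.1 h.mem (fun hc => h.leg.2 _ hc h'.root.1)
    have h2 := hT.dist_eq_add_of_inBranch h'.leg.1 h'.mem (fun hc => h'.leg.2 _ hc h.root.1)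
    have h3 := hT.connected.pos_dist_of_ne hne
    rw [T.dist_comm (u := w') (v := w)] at h1
    omega
  subst hww
  exact ⟨rfl, hT.inBranch_unique h.leg.1 h'.leg.1 h.mem h'.mem⟩

/-- A leg root is a major vertex, hence on no leg. -/
theorem IsLegRoot.not_onLeg {w v n : V} (hw : T.IsLegRoot w) : ¬ T.OnLeg v n w :=
  fun h => h.leg.2 _ h.mem hw.1

/-- If `ς ≥ 3`, then at most one leg of a leg root consists of a single vertex. -/
theorem IsTree.eq_of_leg_neighbors (hT : T.IsTree) (hs : 3 ≤ T.varsigma) {w n n' : V}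
    (hw : T.IsLegRoot w) (hn : T.IsLeg w n) (hn' : T.IsLeg w n')
    (h : ∀ z, T.Adj n z → z = w) (h' : ∀ z, T.Adj n' z → z = w) : n = n' := by
  have key : ∀ {n}, T.IsLeg w n → (∀ z, T.Adj n z → z = w) → n ∈ T.terminalVertices w := by
    intro n hn h
    obtain ⟨u, hu, hut⟩ := hT.exists_terminal_of_isLeg hw.1 hn
    by_cases hun : u = n
    · simpa [terminalVertices] using hun ▸ hut
    · obtain ⟨q, hq, hqu⟩ := hT.connected.exists_inBranch hun
      rw [h q hq] at hqu
      unfold InBranch at hu hqu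
      omega
  by_contra hne
  have h1 : T.varsigma ≤ ((T.dist n w + T.dist w n' : ℕ) : ℕ∞) :=
    (iInf₂_le w (hw.mem_multiExteriorMajor hT)).trans <|
      (iInf₂_le n (key hn h)).trans <| (iInf₂_le n' (key hn' h')).trans <| iInf_le _ hne
  rw [dist_eq_one_iff_adj.2 hn.1.symm, dist_eq_one_iff_adj.2 hn'.1] at h1
  exact absurd (hs.trans h1) (by decide)

end Legs

/-! ### Partitions given by labellings -/

section Labelling

variable {V : Type*} [Fintype V] {T : SimpleGraph V} {L : Type*} [DecidableEq L]

/-- The distance from `x` to the part of the vertices with label `l`. -/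
noncomputable def partDist (T : SimpleGraph V) (f : V → L) (x : V) (l : L) : ℕ :=
  T.distToSet x (Finset.univ.filter (fun z => f z = l))

theorem partDist_le {f : V → L} (x : V) {z : V} {l : L} (h : f z = l) :
    T.partDist f x l ≤ T.dist x z :=
  Nat.sInf_le ⟨z, by simpa using h, rfl⟩

theorem exists_partDist_eq {f : V → L} (x : V) {l : L} (h : ∃ z, f z = l) :
    ∃ z, f z = l ∧ T.partDist f x l = T.dist x z := by
  obtain ⟨z, hz⟩ := h
  have hne : (T.dist x '' ((Finset.univ.filter (fun z => f z = l) : Finset V) : Set V)).Nonempty :=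
    ⟨_, z, by simpa using hz, rfl⟩
  obtain ⟨z', hz', h⟩ := Nat.sInf_mem hne
  exact ⟨z', by simpa using hz', h.symm⟩

theorem partDist_self (f : V → L) (x : V) : T.partDist f x (f x) = 0 := by
  have := partDist_le (T := T) (f := f) x (z := x) rfl
  simpa using this

theorem Connected.partDist_ne_zero (hc : T.Connected) {f : V → L} {x : V} {l : L}
    (h : ∃ z, f z = l) (hx : f x ≠ l) : T.partDist f x l ≠ 0 := by
  obtain ⟨z, hz, hd⟩ := exists_partDist_eq (T := T) x h
  rw [hd, Ne, hc.dist_eq_zero_iff]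
  rintro rfl
  exact hx hz

/-- Vertices in different parts are distinguished by both of these parts. -/
theorem Connected.partDist_ne_of_ne (hc : T.Connected) {f : V → L} {x y : V} (h : f x ≠ f y) :
    T.partDist f x (f x) ≠ T.partDist f y (f x) ∧
      T.partDist f x (f y) ≠ T.partDist f y (f y) := by
  rw [partDist_self, partDist_self]
  exact ⟨(hc.partDist_ne_zero ⟨x, rfl⟩ h.symm).symm, hc.partDist_ne_zero ⟨y, rfl⟩ h⟩

/-- A part inside a branch measures, from outside the branch, the distance to its root. -/
theorem IsTree.partDist_eq_add (hT : T.IsTree) {f : V → L} {w n x : V} {l : L} (h : T.Adj w n)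
    (hl : ∀ z, f z = l → T.InBranch w n z) (hne : ∃ z, f z = l) (hx : ¬ T.InBranch w n x) :
    T.partDist f x l = T.dist x w + T.partDist f w l := by
  have key : ∀ z, f z = l → T.dist x z = T.dist x w + T.dist w z := by
    intro z hz
    rw [T.dist_comm, hT.dist_eq_add_of_inBranch h (hl z hz) hx, T.dist_comm, add_comm]
  obtain ⟨z, hz, h1⟩ := exists_partDist_eq (T := T) x hne
  obtain ⟨z', hz', h2⟩ := exists_partDist_eq (T := T) w hne
  have h3 := partDist_le (T := T) x hz'
  have h4 := partDist_le (T := T) w hz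
  rw [key _ hz] at h1
  rw [key _ hz'] at h3
  omega

theorem IsTree.partDist_ne_of_branch (hT : T.IsTree) {f : V → L} {w n x y : V} {l : L}
    (h : T.Adj w n) (hl : ∀ z, f z = l → T.InBranch w n z) (hne : ∃ z, f z = l)
    (hx : ¬ T.InBranch w n x) (hy : ¬ T.InBranch w n y) (hd : T.dist x w ≠ T.dist y w) :
    T.partDist f x l ≠ T.partDist f y l := by
  rw [hT.partDist_eq_add h hl hne hx, hT.partDist_eq_add h hl hne hy]
  omega

/-- A part that contains the root of a branch and misses the branch measures, from inside the
branch, the distance to the root. -/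
theorem IsTree.partDist_eq_dist_root (hT : T.IsTree) {f : V → L} {w n x : V} {l : L}
    (h : T.Adj w n) (hl : ∀ z, f z = l → ¬ T.InBranch w n z) (hw : f w = l)
    (hx : T.InBranch w n x) : T.partDist f x l = T.dist x w := by
  obtain ⟨z, hz, h1⟩ := exists_partDist_eq (T := T) x ⟨w, hw⟩
  have h2 := hT.dist_eq_add_of_inBranch h hx (hl z hz)
  have h3 := partDist_le (T := T) x hw
  omega

/-- The fibres of a labelling form a partition, so the number of labels bounds the partition
dimension as soon as any two vertices are distinguished by `k` labels. -/
theorem partitionDim_le_of_labelling [DecidableEq V] {k : ℕ} (f : V → L) (s : Finset L)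
    (hs : ∀ x, f x ∈ s)
    (h : ∀ x y, x ≠ y → ∃ t : Finset L, k ≤ t.card ∧
      ∀ l ∈ t, T.partDist f x l ≠ T.partDist f y l) :
    T.partitionDim k ≤ (s.card : ℕ∞) := by
  let c : L → Finset V := fun l => Finset.univ.filter (fun z => f z = l)
  have hc : ∀ z l, z ∈ c l ↔ f z = l := by simp [c]
  let P : Finpartition (Finset.univ : Finset V) :=
    Finpartition.ofExistsUnique (Finset.univ.image (fun x => c (f x)))
      (fun _ _ => Finset.subset_univ _)
      (by
        intro a _
        refine ⟨c (f a), ⟨Finset.mem_image_of_mem _ (Finset.mem_univ a), (hc _ _).2 rfl⟩, ?_⟩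
        rintro p ⟨hp, hap⟩
        obtain ⟨x, -, rfl⟩ := Finset.mem_image.1 hp
        rw [(hc _ _).1 hap])
      (by
        intro hcon
        obtain ⟨x, -, hx⟩ := Finset.mem_image.1 hcon
        exact absurd ((hc x (f x)).2 rfl) (by simp [hx]))
  have hP : ∀ x, c (f x) ∈ P.parts := fun x => Finset.mem_image_of_mem _ (Finset.mem_univ x)
  have hgen : T.IsPartitionGenerator k P := by
    intro x y hxy
    obtain ⟨t, hk, ht⟩ := h x y hxy
    -- the distance to an empty part would be zero by convention
    have hne : ∀ l ∈ t, ∃ z, f z = l := by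
      intro l hl
      by_contra hno
      push Not at hno
      have he : Finset.univ.filter (fun z => f z = l) = ∅ := by simpa using hno
      exact ht l hl (by simp [partDist, he, distToSet])
    refine hk.trans (Finset.card_le_card_of_injOn c ?_ ?_)
    · intro l hl
      obtain ⟨z, rfl⟩ := hne l hl
      exact Finset.mem_coe.2 (Finset.mem_filter.2 ⟨hP z, ht _ hl⟩)
    · intro l hl l' _ hll
      obtain ⟨z, rfl⟩ := hne l hl
      exact (hc _ _).1 (hll ▸ (hc z (f z)).2 rfl)
  have hcard : P.parts.card ≤ s.card := by
    refine (Finset.card_le_card (t := s.image c) ?_).trans Finset.card_image_le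
    intro p hp
    obtain ⟨x, -, rfl⟩ := Finset.mem_image.1 hp
    exact Finset.mem_image_of_mem _ (hs x)
  exact (iInf₂_le P hgen).trans (by exact_mod_cast hcard)

end Labelling

/-! ### Labellings along the legs -/

section LegLabelling

/-- A finite set can be numbered from `0` with a prescribed element, if any, coming first. -/
theorem exists_index {α : Type*} (s : Finset α) (p : α → Prop)
    (hp : ∀ a ∈ s, ∀ b ∈ s, p a → p b → a = b) :
    ∃ i : α → ℕ, Set.BijOn i s (Set.Iio s.card) ∧ ∀ a ∈ s, p a → i a = 0 := by
  classical
  let i₀ : α → ℕ := fun x => if h : x ∈ s then (s.equivFin ⟨x, h⟩ : ℕ) else 0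
  have hi₀ : Set.BijOn i₀ s (Set.Iio s.card) := by
    refine ⟨?_, ?_, ?_⟩
    · intro x hx
      have hx' : x ∈ s := hx
      simp [i₀, hx']
    · intro x hx y hy hxy
      have hx' : x ∈ s := hx
      have hy' : y ∈ s := hy
      simpa [i₀, hx', hy', Fin.val_inj] using hxy
    · intro j hj
      refine ⟨s.equivFin.symm ⟨j, hj⟩, (s.equivFin.symm ⟨j, hj⟩).2, ?_⟩
      simp [i₀]
  by_cases h : ∃ a ∈ s, p a
  · obtain ⟨a, ha, hpa⟩ := h
    have h0 : 0 < s.card := Finset.card_pos.2 ⟨a, ha⟩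
    have ha' : i₀ a < s.card := hi₀.mapsTo ha
    refine ⟨Equiv.swap (i₀ a) 0 ∘ i₀, Set.BijOn.comp (t := Set.Iio s.card) ?_ hi₀, ?_⟩
    · refine ⟨?_, (Equiv.injective _).injOn, ?_⟩
      · intro j hj
        rw [Set.mem_Iio] at hj ⊢
        rw [Equiv.swap_apply_def]
        split_ifs <;> assumption
      · intro j hj
        rw [Set.mem_Iio] at hj
        refine ⟨Equiv.swap (i₀ a) 0 j, ?_, Equiv.swap_apply_self _ _ _⟩
        rw [Set.mem_Iio, Equiv.swap_apply_def]
        split_ifs <;> assumption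
    · intro b hb hpb
      rw [hp b hb a ha hpb hpa]
      simp
  · exact ⟨i₀, hi₀, fun a ha hpa => absurd ⟨a, ha, hpa⟩ h⟩

variable {V : Type*} [Fintype V] {T : SimpleGraph V} [DecidableRel T.Adj]

/-- A numbering of the legs of every leg root. -/
def IsLegIndex (T : SimpleGraph V) [DecidableRel T.Adj] (idx : V → V → ℕ) : Prop :=
  ∀ w, Set.BijOn (idx w) (T.legs w) (Set.Iio (T.legs w).card)

theorem IsLegIndex.inj {idx : V → V → ℕ} (hi : T.IsLegIndex idx) {w n n' : V} (hn : T.IsLeg w n)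
    (hn' : T.IsLeg w n') (h : idx w n = idx w n') : n = n' :=
  (hi w).injOn (mem_legs.2 hn) (mem_legs.2 hn') h

theorem IsLegIndex.lt {idx : V → V → ℕ} (hT : T.IsTree) (hi : T.IsLegIndex idx) {w n : V}
    (hw : T.IsLegRoot w) (hn : T.IsLeg w n) : idx w n < T.maxTerminalDegree :=
  lt_of_lt_of_le ((hi w).mapsTo (mem_legs.2 hn)) (hw.card_legs_le_maxTerminalDegree hT)

theorem IsLegIndex.exists_leg {idx : V → V → ℕ} (hi : T.IsLegIndex idx) {w : V}
    (hw : T.IsLegRoot w) {i : ℕ} (h : i < 2) : ∃ n, T.IsLeg w n ∧ idx w n = i := by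
  obtain ⟨n, hn, h⟩ := (hi w).surjOn (show i ∈ Set.Iio (T.legs w).card from lt_of_lt_of_le h hw.2)
  exact ⟨n, mem_legs.1 hn, h⟩

/-- Labels can be prescribed along the legs, since these are disjoint. -/
theorem IsTree.exists_labelling (hT : T.IsTree) {L : Type*} (g : V → V → V → L) (r : L) :
    ∃ f : V → L, (∀ w n x, T.OnLeg w n x → f x = g w n x) ∧
      ∀ x, (¬ ∃ w n, T.OnLeg w n x) → f x = r := by
  have h : ∀ x, ∃ l, (∀ w n, T.OnLeg w n x → l = g w n x) ∧
      ((¬ ∃ w n, T.OnLeg w n x) → l = r) := by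
    intro x
    by_cases hx : ∃ w n, T.OnLeg w n x
    · obtain ⟨w, n, hx⟩ := hx
      refine ⟨g w n x, fun w' n' h => ?_, fun h => absurd ⟨w, n, hx⟩ h⟩
      obtain ⟨rfl, rfl⟩ := hx.unique hT h
      rfl
    · exact ⟨r, fun w n h => absurd ⟨w, n, h⟩ hx, fun _ => rfl⟩
  choose f hf using h
  exact ⟨f, fun w n x h => (hf x).1 w n h, fun x h => (hf x).2 h⟩

/-- The part of the vertices on no leg distinguishes vertices on legs of the same root whose
distances to the root differ. -/
theorem IsTree.partDist_rest_ne (hT : T.IsTree) {L : Type*} [DecidableEq L] {f : V → L} {r : L}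
    (hf : ∀ x, f x = r ↔ ¬ ∃ w n, T.OnLeg w n x) {w n n' x y : V} (hx : T.OnLeg w n x)
    (hy : T.OnLeg w n' y) (hd : T.dist x w ≠ T.dist y w) :
    T.partDist f x r ≠ T.partDist f y r := by
  have hw : f w = r := (hf w).2 (fun ⟨_, _, h⟩ => hx.root.not_onLeg h)
  rw [hT.partDist_eq_dist_root hx.leg.1 (fun z hz hzb => (hf z).1 hz ⟨w, n, hx.1, hx.2, hzb⟩) hw
    hx.mem, hT.partDist_eq_dist_root hy.leg.1
      (fun z hz hzb => (hf z).1 hz ⟨w, n', hy.1, hy.2, hzb⟩) hw hy.mem]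
  exact hd

/-- The labels: `none` outside the legs, `some (some w, j)` for a part on the legs of the leg
root `w` only, and `some (none, j)` for a part shared by all leg roots. -/
abbrev LegLabel (V : Type*) := Option (Option V × ℕ)

open Classical in
/-- The labels with `c` private parts for each vertex of `M` and shared parts numbered from `a`
to `b - 1`. -/
noncomputable def legLabels (M : Finset V) (c a b : ℕ) : Finset (LegLabel V) :=
  insert none ((M.image some ×ˢ Finset.range c ∪ {none} ×ˢ Finset.Ico a b).image some)

theorem card_legLabels_le {W : Type*} (M : Finset W) (c a b : ℕ) :
    (legLabels M c a b).card ≤ c * M.card + (b - a) + 1 := by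
  classical
  unfold legLabels
  refine (Finset.card_insert_le _ _).trans (Nat.succ_le_succ (Finset.card_image_le.trans
    ((Finset.card_union_le _ _).trans ?_)))
  simp only [Finset.card_product, Finset.card_range, Finset.card_singleton, Nat.card_Ico, one_mul]
  rw [mul_comm c]
  exact Nat.add_le_add_right (Nat.mul_le_mul_right _ Finset.card_image_le) _

end LegLabelling

/-! ### The two partitions -/

section Generators

variable {V : Type*} [Fintype V] [DecidableEq V] {T : SimpleGraph V} [DecidableRel T.Adj]

/-- Each leg is one part: the first two legs of a leg root are private to that root, the `i`-th
legs of all leg roots together form one part for every `i ≥ 2`. -/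
theorem IsTree.partitionDim_two_add_one_le (hT : T.IsTree)
    (hpath : ¬ ∃ n : ℕ, Nonempty (T ≃g SimpleGraph.pathGraph n)) :
    T.partitionDim 2 + 1 ≤
      ((2 * T.multiExteriorMajor.card + T.maxTerminalDegree : ℕ) : ℕ∞) := by
  classical
  have hi : ∃ idx, T.IsLegIndex idx := by
    choose idx hidx _ using fun w => exists_index (T.legs w) (fun _ => False) (by simp)
    exact ⟨idx, hidx⟩
  obtain ⟨idx, hi⟩ := hi
  let g : V → V → V → LegLabel V := fun w n _ =>
    some (if idx w n < 2 then some w else none, idx w n)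
  obtain ⟨f, hf, hf'⟩ := hT.exists_labelling g none
  have hrest : ∀ x, f x = none ↔ ¬ ∃ w n, T.OnLeg w n x := by
    refine fun x => ⟨?_, hf' x⟩
    rintro h ⟨w, n, hx⟩
    simp [hf w n x hx, g] at h
  have hmem : ∀ x, f x ∈ legLabels T.multiExteriorMajor 2 2 T.maxTerminalDegree := by
    intro x
    by_cases hx : ∃ w n, T.OnLeg w n x
    · obtain ⟨w, n, hx⟩ := hx
      have h1 := hi.lt hT hx.root hx.leg
      have h2 := hx.root.mem_multiExteriorMajor hT
      rw [hf w n x hx]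
      by_cases h3 : idx w n < 2
      · simp only [legLabels, g, if_pos h3]
        simp [h2, Nat.le_of_lt_succ h3]
      · simp only [legLabels, g, if_neg h3]
        simp [h1, not_lt.1 h3]
    · simp [hf' x hx, legLabels]
  have hpriv : ∀ w n, T.IsLegRoot w → T.IsLeg w n → idx w n < 2 →
      ∀ z, f z = some (some w, idx w n) ↔ T.InBranch w n z := by
    intro w n hw hn h z
    constructor
    · intro hz
      by_cases hx : ∃ w n, T.OnLeg w n z
      · obtain ⟨w', n', hx⟩ := hx
        rw [hf w' n' z hx] at hz
        simp only [g, Option.some.injEq, Prod.mk.injEq] at hz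
        obtain ⟨h1, h2⟩ := hz
        split_ifs at h1
        obtain rfl := Option.some.inj h1
        exact hi.inj hx.leg hn h2 ▸ hx.mem
      · simp [hf' z hx] at hz
    · intro hz
      rw [hf w n z ⟨hw, hn, hz⟩]
      simp only [g, if_pos h]
  have hdist : ∀ x y, x ≠ y → ∃ t : Finset (LegLabel V), 2 ≤ t.card ∧
      ∀ l ∈ t, T.partDist f x l ≠ T.partDist f y l := by
    intro x y hxy
    by_cases hfxy : f x = f y
    swap
    · refine ⟨{f x, f y}, (Finset.card_pair hfxy).ge, ?_⟩
      simpa using hT.connected.partDist_ne_of_ne hfxy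
    by_cases hR : ∀ w, T.IsLegRoot w → T.dist x w = T.dist y w
    · -- then `x` and `y` lie on different legs of one root, hence in different parts
      exfalso
      obtain ⟨w, n, n', hw, hn, hn', hnn, hx, hy, -⟩ := hT.exists_legs_of_dist_eq hpath hxy hR
      rw [hf w n x ⟨hw, hn, hx⟩, hf w n' y ⟨hw, hn', hy⟩] at hfxy
      simp only [g, Option.some.injEq, Prod.mk.injEq] at hfxy
      exact hnn (hi.inj hn hn' hfxy.2)
    push Not at hR
    obtain ⟨w, hw, hd⟩ := hR
    obtain ⟨n₀, hn₀, h₀⟩ := hi.exists_leg hw (i := 0) (by simp)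
    obtain ⟨n₁, hn₁, h₁⟩ := hi.exists_leg hw (i := 1) (by simp)
    have p₀ := hpriv w n₀ hw hn₀ (by omega)
    have p₁ := hpriv w n₁ hw hn₁ (by omega)
    rw [h₀] at p₀
    rw [h₁] at p₁
    have hxy₀ : T.InBranch w n₀ x ↔ T.InBranch w n₀ y := by rw [← p₀, ← p₀, hfxy]
    have hxy₁ : T.InBranch w n₁ x ↔ T.InBranch w n₁ y := by rw [← p₁, ← p₁, hfxy]
    have d₀ := fun hx hy => hT.partDist_ne_of_branch hn₀.1 (fun z => (p₀ z).1)
      ⟨n₀, (p₀ n₀).2 (inBranch_self hn₀.1)⟩ (x := x) (y := y) hx hy hd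
    have d₁ := fun hx hy => hT.partDist_ne_of_branch hn₁.1 (fun z => (p₁ z).1)
      ⟨n₁, (p₁ n₁).2 (inBranch_self hn₁.1)⟩ (x := x) (y := y) hx hy hd
    have h01 : ∀ z, T.InBranch w n₀ z → ¬ T.InBranch w n₁ z := by
      intro z hz hz'
      rw [← p₀] at hz
      rw [← p₁, hz] at hz'
      simp at hz'
    by_cases hx₀ : T.InBranch w n₀ x
    · have hd' := hT.partDist_rest_ne hrest ⟨hw, hn₀, hx₀⟩ ⟨hw, hn₀, hxy₀.1 hx₀⟩ hd
      refine ⟨{some (some w, 1), none}, (Finset.card_pair (by simp)).ge, ?_⟩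
      simpa using ⟨d₁ (h01 x hx₀) (h01 y (hxy₀.1 hx₀)), hd'⟩
    · have hy₀ := fun h => hx₀ (hxy₀.2 h)
      by_cases hx₁ : T.InBranch w n₁ x
      · have hd' := hT.partDist_rest_ne hrest ⟨hw, hn₁, hx₁⟩ ⟨hw, hn₁, hxy₁.1 hx₁⟩ hd
        refine ⟨{some (some w, 0), none}, (Finset.card_pair (by simp)).ge, ?_⟩
        simpa using ⟨d₀ hx₀ hy₀, hd'⟩
      · refine ⟨{some (some w, 0), some (some w, 1)}, (Finset.card_pair (by simp)).ge, ?_⟩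
        simpa using ⟨d₀ hx₀ hy₀, d₁ hx₁ (fun h => hx₁ (hxy₁.2 h))⟩
  have hle := partitionDim_le_of_labelling f _ hmem hdist
  have hcard := card_legLabels_le T.multiExteriorMajor 2 2 T.maxTerminalDegree
  obtain ⟨w, hw⟩ := hT.exists_isLegRoot hpath
  have hτ : 2 ≤ T.maxTerminalDegree := hw.2.trans_le (hw.card_legs_le_maxTerminalDegree hT)
  refine (add_le_add_left hle 1).trans ?_
  norm_cast
  omega

/-- Each leg except the first one of a leg root is cut into its first vertex and the remainder,
which is nonempty as only the first leg may be a single vertex. The parts of the first two legs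
are private to the root, the others are shared by all leg roots. -/
theorem IsTree.partitionDim_three_add_three_le (hT : T.IsTree)
    (hpath : ¬ ∃ n : ℕ, Nonempty (T ≃g SimpleGraph.pathGraph n)) (hs : 3 ≤ T.varsigma) :
    T.partitionDim 3 + 3 ≤
      ((3 * T.multiExteriorMajor.card + 2 * T.maxTerminalDegree : ℕ) : ℕ∞) := by
  classical
  have hi : ∃ idx, T.IsLegIndex idx ∧ ∀ w n, T.IsLegRoot w → T.IsLeg w n → idx w n ≠ 0 →
      ∃ z, T.Adj n z ∧ z ≠ w := by
    choose idx hidx h0 using fun w => exists_index (T.legs w)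
      (fun n => T.IsLegRoot w ∧ ∀ z, T.Adj n z → z = w)
      (fun n hn n' hn' h h' => hT.eq_of_leg_neighbors hs h.1 (mem_legs.1 hn) (mem_legs.1 hn')
        h.2 h'.2)
    refine ⟨idx, hidx, fun w n hw hn h => ?_⟩
    by_contra! hno
    exact h (h0 w n (mem_legs.2 hn) ⟨hw, hno⟩)
  obtain ⟨idx, hi, hlong⟩ := hi
  -- the second vertex of a leg of nonzero index
  have hsecond : ∀ w n, T.IsLegRoot w → T.IsLeg w n → idx w n ≠ 0 →
      ∃ z, T.Adj n z ∧ z ≠ n ∧ T.InBranch w n z := by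
    intro w n hw hn h
    obtain ⟨z, hz, hzw⟩ := hlong w n hw hn h
    have hwz : ¬ T.InBranch n z w :=
      fun hc => hzw (hT.inBranch_unique hz hn.1.symm hc (inBranch_self hn.1.symm))
    exact ⟨z, hz, hz.ne', (hT.inBranch_of_inBranch hn.1 (inBranch_self hn.1) hz hwz
      (inBranch_self hz)).1⟩
  let g : V → V → V → LegLabel V := fun w n x =>
    some (if idx w n = 0 then (some w, 0) else
      if idx w n = 1 then (some w, if x = n then 1 else 2) else
        (none, 2 * idx w n + if x = n then 0 else 1))
  -- the label determines the index of the leg and, on a leg that is cut, which piece it is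
  have hg : ∀ w n x w' n' x', g w n x = g w' n' x' → idx w n = idx w' n' := by
    intro w n x w' n' x' h
    simp only [g] at h
    grind
  have hg' : ∀ w n x, idx w n ≠ 0 → x ≠ n → g w n x ≠ g w n n := by
    intro w n x h hx
    simp only [g, if_neg h, if_neg hx]
    split_ifs <;> simp
  obtain ⟨f, hf, hf'⟩ := hT.exists_labelling g none
  have hrest : ∀ x, f x = none ↔ ¬ ∃ w n, T.OnLeg w n x := by
    refine fun x => ⟨?_, hf' x⟩
    rintro h ⟨w, n, hx⟩
    simp [hf w n x hx, g] at h
  have hmem : ∀ x, f x ∈ legLabels T.multiExteriorMajor 3 4 (2 * T.maxTerminalDegree) := by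
    intro x
    by_cases hx : ∃ w n, T.OnLeg w n x
    · obtain ⟨w, n, hx⟩ := hx
      have h1 := hi.lt hT hx.root hx.leg
      have h2 := hx.root.mem_multiExteriorMajor hT
      rw [hf w n x hx]
      by_cases h3 : idx w n = 0
      · simp [legLabels, g, h3, h2]
      by_cases h4 : idx w n = 1
      · by_cases h5 : x = n <;> simp [legLabels, g, h4, h2, h5]
      · by_cases h5 : x = n <;> simp [legLabels, g, h3, h4, h5] <;> omega
    · simp [hf' x hx, legLabels]
  have hpriv : ∀ w j z, f z = some (some w, j) →
      ∃ n, T.OnLeg w n z ∧ g w n z = some (some w, j) := by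
    intro w j z hz
    by_cases hx : ∃ w n, T.OnLeg w n z
    · obtain ⟨w', n', hx⟩ := hx
      have hz' := hz
      rw [hf w' n' z hx] at hz'
      have : w' = w := by
        simp only [g] at hz'
        grind
      subst this
      exact ⟨n', hx, hz'⟩
    · simp [hf' z hx] at hz
  have hdist : ∀ x y, x ≠ y → ∃ t : Finset (LegLabel V), 3 ≤ t.card ∧
      ∀ l ∈ t, T.partDist f x l ≠ T.partDist f y l := by
    intro x y hxy
    -- when the vertices lie in different parts, one further part suffices
    have hthird : f x ≠ f y → (∃ l, l ≠ f x ∧ l ≠ f y ∧ T.partDist f x l ≠ T.partDist f y l) →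
        ∃ t : Finset (LegLabel V), 3 ≤ t.card ∧
          ∀ l ∈ t, T.partDist f x l ≠ T.partDist f y l := by
      rintro hfxy ⟨l, hlx, hly, hl⟩
      obtain ⟨h1, h2⟩ := hT.connected.partDist_ne_of_ne hfxy
      refine ⟨{l, f x, f y}, (Finset.card_eq_three.2 ⟨_, _, _, hlx, hly, hfxy, rfl⟩).ge, ?_⟩
      simpa using ⟨hl, h1, h2⟩
    by_cases hR : ∀ w, T.IsLegRoot w → T.dist x w = T.dist y w
    · obtain ⟨w, n, n', hw, hn, hn', hnn, hx, hy, hd⟩ := hT.exists_legs_of_dist_eq hpath hxy hR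
      -- the third part is the other part of a leg that has been cut
      have key : ∀ {x y n n' : V}, T.OnLeg w n x → T.OnLeg w n' y → n ≠ n' →
          T.dist x w = T.dist y w → idx w n ≠ 0 →
          ∃ l, l ≠ f x ∧ l ≠ f y ∧ T.partDist f x l ≠ T.partDist f y l := by
        intro x y n n' hx hy hnn hd h0
        obtain ⟨z, hz, hzx, hzd⟩ : ∃ z, T.InBranch w n z ∧ g w n z ≠ g w n x ∧
            T.dist x z ≤ T.dist x w := by
          by_cases hxn : x = n
          · obtain ⟨z, hz, hzn, hzb⟩ := hsecond w n hw hx.leg h0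
            refine ⟨z, hzb, hxn ▸ hg' w n z h0 hzn, ?_⟩
            rw [hxn, dist_eq_one_iff_adj.2 hz, dist_eq_one_iff_adj.2 hx.leg.1.symm]
          · refine ⟨n, inBranch_self hx.leg.1, (hg' w n x h0 hxn).symm, ?_⟩
            have h1 := hx.mem
            unfold InBranch at h1
            omega
        have hfz := hf w n z ⟨hw, hx.leg, hz⟩
        have hidx : ∀ v, T.InBranch w n' v → f v ≠ g w n z := by
          intro v hv hc
          rw [hf w n' v ⟨hw, hy.leg, hv⟩] at hc
          exact hnn (hi.inj hx.leg hy.leg (hg _ _ _ _ _ _ hc).symm)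
        refine ⟨g w n z, hf w n x hx ▸ hzx, (hidx y hy.mem).symm, ?_⟩
        obtain ⟨v, hv, hyv⟩ := exists_partDist_eq (T := T) y ⟨z, hfz⟩
        have h1 := hT.dist_eq_add_of_inBranch hy.leg.1 hy.mem (fun h => hidx v h hv)
        have h2 := partDist_le (T := T) x hfz
        have h3 : v ≠ w := by
          rintro rfl
          rw [hf' v (fun ⟨_, _, h⟩ => hw.not_onLeg h)] at hv
          simp [g] at hv
        have h4 := hT.connected.pos_dist_of_ne h3
        omega
      have hfxy : f x ≠ f y := by
        rw [hf w n x ⟨hw, hn, hx⟩, hf w n' y ⟨hw, hn', hy⟩]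
        exact fun h => hnn (hi.inj hn hn' (hg _ _ _ _ _ _ h))
      refine hthird hfxy ?_
      by_cases h0 : idx w n = 0
      · obtain ⟨l, h1, h2, h3⟩ := key ⟨hw, hn', hy⟩ ⟨hw, hn, hx⟩ hnn.symm hd.symm
          (fun h => hnn (hi.inj hn hn' (h0.trans h.symm)))
        exact ⟨l, h2, h1, h3.symm⟩
      · exact key ⟨hw, hn, hx⟩ ⟨hw, hn', hy⟩ hnn hd h0
    push Not at hR
    obtain ⟨w, hw, hd⟩ := hR
    obtain ⟨n₀, hn₀, h₀⟩ := hi.exists_leg hw (i := 0) (by simp)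
    obtain ⟨n₁, hn₁, h₁⟩ := hi.exists_leg hw (i := 1) (by simp)
    have hb₀ := inBranch_self hn₀.1
    have hb₁ := inBranch_self hn₁.1
    have g₀ : ∀ z, g w n₀ z = some (some w, 0) := by intro z; simp [g, h₀]
    have g₁ : ∀ z, g w n₁ z = some (some w, if z = n₁ then 1 else 2) := by
      intro z; simp [g, h₁]
    -- the private parts of `w`
    have p₀ : ∀ z, f z = some (some w, 0) ↔ T.InBranch w n₀ z := by
      refine fun z => ⟨fun hz => ?_, fun hz => (hf w n₀ z ⟨hw, hn₀, hz⟩).trans (g₀ z)⟩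
      obtain ⟨n, hx, hgz⟩ := hpriv w 0 z hz
      exact hi.inj hx.leg hn₀ (hg _ _ _ _ _ _ (hgz.trans (g₀ z).symm)) ▸ hx.mem
    have p₁ : ∀ z, f z = some (some w, 1) ↔ z = n₁ := by
      refine fun z => ⟨fun hz => ?_, ?_⟩
      · obtain ⟨n, hx, hgz⟩ := hpriv w 1 z hz
        obtain rfl := hi.inj hx.leg hn₁
          (hg _ _ _ _ _ n₁ (hgz.trans (by rw [g₁, if_pos rfl])))
        by_contra hne
        simp [g₁, hne] at hgz
      · rintro rfl
        rw [hf w z z ⟨hw, hn₁, hb₁⟩, g₁, if_pos rfl]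
    obtain ⟨v, -, hvn, hvb⟩ := hsecond w n₁ hw hn₁ (by omega)
    have p₂ : ∀ z, f z = some (some w, 2) ↔ T.InBranch w n₁ z ∧ z ≠ n₁ := by
      refine fun z => ⟨fun hz => ?_, ?_⟩
      · obtain ⟨n, hx, hgz⟩ := hpriv w 2 z hz
        obtain rfl := hi.inj hx.leg hn₁ (hg _ _ _ _ _ v (hgz.trans (by rw [g₁, if_neg hvn])))
        refine ⟨hx.mem, ?_⟩
        rintro rfl
        simp [g₁] at hgz
      · rintro ⟨hz, hne⟩
        rw [hf w n₁ z ⟨hw, hn₁, hz⟩, g₁, if_neg hne]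
    have d₀ := fun hx hy => hT.partDist_ne_of_branch hn₀.1 (fun z => (p₀ z).1)
      ⟨n₀, (p₀ n₀).2 hb₀⟩ (x := x) (y := y) hx hy hd
    have d₁ := fun hx hy => hT.partDist_ne_of_branch hn₁.1
      (fun z hz => ((p₁ z).1 hz).symm ▸ hb₁) ⟨n₁, (p₁ n₁).2 rfl⟩ (x := x) (y := y) hx hy hd
    have d₂ := fun hx hy => hT.partDist_ne_of_branch hn₁.1 (fun z hz => ((p₂ z).1 hz).1)
      ⟨v, (p₂ v).2 ⟨hvb, hvn⟩⟩ (x := x) (y := y) hx hy hd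
    have h01 : ∀ z, T.InBranch w n₀ z → ¬ T.InBranch w n₁ z := by
      intro z hz hz'
      have := hT.inBranch_unique hn₀.1 hn₁.1 hz hz'
      subst this
      omega
    by_cases hfxy : f x = f y
    · have hxy₀ : T.InBranch w n₀ x ↔ T.InBranch w n₀ y := by rw [← p₀, ← p₀, hfxy]
      have hxn : x ≠ n₁ := by
        rintro rfl
        rw [(p₁ x).2 rfl] at hfxy
        exact hxy ((p₁ y).1 hfxy.symm).symm
      have hyn : y ≠ n₁ := by
        rintro rfl
        rw [(p₁ y).2 rfl] at hfxy
        exact hxy ((p₁ x).1 hfxy)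
      have hxy₁ : T.InBranch w n₁ x ↔ T.InBranch w n₁ y := by
        have : f x = some (some w, 2) ↔ f y = some (some w, 2) := by rw [hfxy]
        simpa [p₂, hxn, hyn] using this
      by_cases hx₀ : T.InBranch w n₀ x
      · have hy₀ := hxy₀.1 hx₀
        have hd' := hT.partDist_rest_ne hrest ⟨hw, hn₀, hx₀⟩ ⟨hw, hn₀, hy₀⟩ hd
        refine ⟨{some (some w, 1), some (some w, 2), none},
          (Finset.card_eq_three.2 ⟨_, _, _, by simp, by simp, by simp, rfl⟩).ge, ?_⟩
        simpa using ⟨d₁ (h01 x hx₀) (h01 y hy₀), d₂ (h01 x hx₀) (h01 y hy₀), hd'⟩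
      have hy₀ := fun h => hx₀ (hxy₀.2 h)
      by_cases hx₁ : T.InBranch w n₁ x
      · have hy₁ := hxy₁.1 hx₁
        have hd' := hT.partDist_rest_ne hrest ⟨hw, hn₁, hx₁⟩ ⟨hw, hn₁, hy₁⟩ hd
        have hd₁ : T.partDist f x (some (some w, 1)) ≠ T.partDist f y (some (some w, 1)) := by
          obtain ⟨a, ha, hxa⟩ := exists_partDist_eq (T := T) x ⟨n₁, (p₁ n₁).2 rfl⟩
          obtain ⟨b, hb, hyb⟩ := exists_partDist_eq (T := T) y ⟨n₁, (p₁ n₁).2 rfl⟩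
          rw [hxa, hyb, (p₁ a).1 ha, (p₁ b).1 hb]
          unfold InBranch at hx₁ hy₁
          omega
        refine ⟨{some (some w, 0), some (some w, 1), none},
          (Finset.card_eq_three.2 ⟨_, _, _, by simp, by simp, by simp, rfl⟩).ge, ?_⟩
        simpa using ⟨d₀ hx₀ hy₀, hd₁, hd'⟩
      · have hy₁ := fun h => hx₁ (hxy₁.2 h)
        refine ⟨{some (some w, 0), some (some w, 1), some (some w, 2)},
          (Finset.card_eq_three.2 ⟨_, _, _, by simp, by simp, by simp, rfl⟩).ge, ?_⟩
        simpa using ⟨d₀ hx₀ hy₀, d₁ hx₁ hy₁, d₂ hx₁ hy₁⟩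
    · refine hthird hfxy ?_
      -- unless one of the two private legs avoids both vertices, each contains one of them
      by_cases ho₀ : ¬ T.InBranch w n₀ x ∧ ¬ T.InBranch w n₀ y
      · exact ⟨_, fun h => ho₀.1 ((p₀ x).1 h.symm), fun h => ho₀.2 ((p₀ y).1 h.symm),
          d₀ ho₀.1 ho₀.2⟩
      by_cases ho₁ : ¬ T.InBranch w n₁ x ∧ ¬ T.InBranch w n₁ y
      · exact ⟨_, fun h => ho₁.1 ((p₁ x).1 h.symm ▸ hb₁), fun h => ho₁.2 ((p₁ y).1 h.symm ▸ hb₁),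
          d₁ ho₁.1 ho₁.2⟩
      obtain ⟨a, b, hx, hy⟩ : ∃ a b, T.OnLeg w a x ∧ T.OnLeg w b y := by
        by_cases hx₀ : T.InBranch w n₀ x
        · have hy₁ : T.InBranch w n₁ y := by
            by_contra hc
            exact ho₁ ⟨h01 x hx₀, hc⟩
          exact ⟨n₀, n₁, ⟨hw, hn₀, hx₀⟩, ⟨hw, hn₁, hy₁⟩⟩
        · have hy₀ : T.InBranch w n₀ y := by
            by_contra hc
            exact ho₀ ⟨hx₀, hc⟩
          have hx₁ : T.InBranch w n₁ x := by
            by_contra hc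
            exact ho₁ ⟨hc, h01 y hy₀⟩
          exact ⟨n₁, n₀, ⟨hw, hn₁, hx₁⟩, ⟨hw, hn₀, hy₀⟩⟩
      exact ⟨none, fun h => (hrest x).1 h.symm ⟨w, a, hx⟩, fun h => (hrest y).1 h.symm ⟨w, b, hy⟩,
        hT.partDist_rest_ne hrest hx hy hd⟩
  have hle := partitionDim_le_of_labelling f _ hmem hdist
  have hcard := card_legLabels_le T.multiExteriorMajor 3 4 (2 * T.maxTerminalDegree)
  obtain ⟨w, hw⟩ := hT.exists_isLegRoot hpath
  have hτ : 2 ≤ T.maxTerminalDegree := hw.2.trans_le (hw.card_legs_le_maxTerminalDegree hT)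
  refine (add_le_add_left hle 3).trans ?_
  norm_cast
  omega

end Generators

end SimpleGraph

theorem mainTheorem11 {V : Type*} [Fintype V] [DecidableEq V] (T : SimpleGraph V)
    [DecidableRel T.Adj] (hT : T.IsTree)
    (hpath : ¬ ∃ n : ℕ, Nonempty (T ≃g SimpleGraph.pathGraph n)) :
    (T.partitionDim 2 + 1 ≤
      ((2 * T.multiExteriorMajor.card + T.maxTerminalDegree : ℕ) : ℕ∞)) ∧
    (3 ≤ T.varsigma →
      T.partitionDim 3 + 3 ≤
        ((3 * T.multiExteriorMajor.card + 2 * T.maxTerminalDegree : ℕ) : ℕ∞)) :=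
  ⟨hT.partitionDim_two_add_one_le hpath, hT.partitionDim_three_add_three_le hpath⟩
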